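/- Let $\mathcal K$ be a finitely accessible additive category, that is, an additive category (preadditive, with finite direct sums) which has all direct limits and in which there is a set $\mathcal S$ of finitely presented objects such that every object of $\mathcal K$ is a direct limit of objects from $\mathcal S$; here an object $F$ is finitely presented if $\operatorname{Hom}_{\mathcal K}(F,-)$ preserves direct limits. A kernel-cokernel pair $K \xrightarrow{i} M \xrightarrow{p} L$ in $\mathcal K$ (that is, $i$ is a kernel of $p$ and $p$ is a cokernel of $i$) is called pure if for every finitely presented object $P$ the sequence of abelian groups $$0 \to \operatorname{Hom}_{\mathcal K}(P,K) \to \operatorname{Hom}_{\mathcal K}(P,M) \to \operatorname{Hom}_{\mathcal K}(P,L) \to 0$$ is exact; a pure monomorphism is a morphism that occurs as the first map $i$ of a pure kernel-cokernel pair. An object $E$ is pure-injective relative to an object $X$ if for every pure monomorphism $i : K \to X$ and every morphism $f : K \to E$ there is a morphism $g : X \to E$ with $g i = f$; it is pure-injective if it is pure-injective relative to every object of $\mathcal K$. Theorem (Baer criterion). For every finitely accessible additive category $\mathcal K$ there exists a cardinal number $\kappa$ such that, if $$\mathcal G = \Big\{ \bigoplus_{i \in I} G_i \;\Big|\; \text{each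 } G_i \text{ is finitely presented and } |I| \le \kappa \Big\},$$ then every object of $\mathcal K$ that is pure-injective relative to each object of $\mathcal G$ is pure-injective. -/

import Mathlib

open CategoryTheory CategoryTheory.Limits

universe w v u

namespace PureExact

variable {C : Type u} [Category.{v} C] [Preadditive C]

/-- A kernel-cokernel pair `K ⟶ M ⟶ L`: the first map is a kernel of the second one,
and the second map is a cokernel of the first one. -/
structure IsKernelCokernelPair (S : ShortComplex C) : Prop where
  isKernel : Nonempty (IsLimit (KernelFork.ofι S.f S.zero))
  isCokernel : Nonempty (IsColimit (CokernelCofork.ofπ S.g S.zero))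

/-- A pure kernel-cokernel pair (a conflation of the pure-exact structure): for every finitely
presented object `P`, the sequence of abelian groups
`0 ⟶ Hom(P, K) ⟶ Hom(P, M) ⟶ Hom(P, L) ⟶ 0` is exact.
The universe `w` is the one of the filtered diagrams in the definition of
finitely presented objects. -/
structure IsPure (S : ShortComplex C) : Prop extends IsKernelCokernelPair S where
  shortExact (P : C) (hP : IsFinitelyPresentable.{w} P) :
    (S.map (preadditiveCoyoneda.obj (Opposite.op P))).ShortExact

/-- Pure monomorphisms: the inflations of the pure-exact structure. -/
def IsPureMono {K M : C} (i : K ⟶ M) : Prop :=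
  ∃ (L : C) (p : M ⟶ L) (zero : i ≫ p = 0), IsPure.{w} (ShortComplex.mk i p zero)

/-- `E` is pure-injective relative to the object `X`: it is injective with respect to every
pure monomorphism with codomain `X`. -/
def IsPureInjectiveRel (E X : C) : Prop :=
  ∀ ⦃K : C⦄ (i : K ⟶ X), IsPureMono.{w} i → ∀ f : K ⟶ E, ∃ g : X ⟶ E, i ≫ g = f

/-- `E` is pure-injective: it is injective with respect to every pure monomorphism. -/
def IsPureInjective (E : C) : Prop :=
  ∀ ⦃K X : C⦄ (i : K ⟶ X), IsPureMono.{w} i → ∀ f : K ⟶ E, ∃ g : X ⟶ E, i ≫ g = f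

/-- The class of the objects that are a direct sum (coproduct) of a family, indexed by a set of
cardinality at most `κ`, of finitely presented objects. -/
def directSumsOfFinitelyPresented (C : Type u) [Category.{v} C] (κ : Cardinal.{w}) :
    ObjectProperty C := fun X ↦
  ∃ (I : Type w) (G : I → C) (inj : ∀ i, G i ⟶ X),
    Cardinal.mk I ≤ κ ∧ (∀ i, IsFinitelyPresentable.{w} (G i)) ∧
      Nonempty (IsColimit (Cofan.mk X inj))

end PureExact

namespace PureExact

/-! An object `X` is determined by the functor `Hom(ι -, X)` on a small category `S` of finitely
presented objects. Pure subobjects of `X` correspond to subfunctors closed under solving one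
divisibility condition, and a morphism from a pure subobject of `X` to `M` is recorded by its graph
(`IsPartialHom`). By Zorn's lemma it suffices to extend such a partial morphism to a larger pure
domain containing a given `x₀` (`exists_extension`).

Let `F` be the current domain. Closing `x₀` under addition, the action of `S` and division modulo
`F` gives a family of values indexed by `FormalExpr`, with `F` + values again pure. The size of this
index set depends only on `S`, not on `X`, `F` or `M`; this is what yields `κ`. The values define a
map `π` from a coproduct of finitely presented objects to `X`, and the preimage of `F` under `π` is
pure in this coproduct. Relative injectivity extends the partial morphism, pulled back along `π`, to
some `g` on the whole coproduct. Since `g` agrees with the old morphism wherever `π` lands in `F`,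
the two glue on `F` + values. -/

/-! ### A small model of the finitely presented objects, and its density. -/

/-- A fully faithful functor from a small category whose essential image consists of all the
finitely presented objects. -/
class IsFinitelyPresentableModel {C : Type u} [Category.{v} C] {S : Type w} [SmallCategory S]
    (ι : S ⥤ C) : Prop extends ι.Full, ι.Faithful where
  presentable (s : S) : IsFinitelyPresentable.{w} (ι.obj s)
  exists_iso (P : C) (hP : IsFinitelyPresentable.{w} P) : ∃ s, Nonempty (ι.obj s ≅ P)

attribute [instance] IsFinitelyPresentableModel.presentable

lemma exists_isFinitelyPresentableModel (C : Type u) [Category.{v} C]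
    [IsFinitelyAccessibleCategory.{w} C] :
    ∃ (S : Type w) (_ : SmallCategory S) (ι : S ⥤ C), IsFinitelyPresentableModel ι := by
  have := Cardinal.fact_isRegular_aleph0.{w}
  let Q : ObjectProperty C := isCardinalPresentable C Cardinal.aleph0.{w}
  have : EssentiallySmall.{w} Q.FullSubcategory := inferInstance
  refine ⟨SmallModel.{w} Q.FullSubcategory, inferInstance,
    (equivSmallModel.{w} Q.FullSubcategory).inverse ⋙ Q.ι, ?_⟩
  exact
    { presentable s := ((equivSmallModel.{w} Q.FullSubcategory).inverse.obj s).property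
      exists_iso P hP :=
        ⟨(equivSmallModel.{w} Q.FullSubcategory).functor.obj ⟨P, hP⟩,
          ⟨Q.ι.mapIso ((equivSmallModel.{w} Q.FullSubcategory).unitIso.app ⟨P, hP⟩).symm⟩⟩ }

lemma exists_isColimit_finitelyPresentable {C : Type u} [Category.{v} C]
    [IsFinitelyAccessibleCategory.{w} C] (X : C) :
    ∃ (J : Type w) (_ : SmallCategory J) (_ : IsFiltered J) (D : J ⥤ C)
      (c : D ⟶ (Functor.const J).obj X),
      Nonempty (IsColimit (Cocone.mk X c)) ∧ ∀ j, IsFinitelyPresentable.{w} (D.obj j) := by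
  have := Cardinal.fact_isRegular_aleph0.{w}
  obtain ⟨P, _, hP⟩ := HasCardinalFilteredGenerator.exists_generator C Cardinal.aleph0.{w}
  obtain ⟨J, _, hJ, ⟨p⟩⟩ := hP.exists_colimitsOfShape X
  exact ⟨J, inferInstance, (isCardinalFiltered_aleph0_iff J).1 hJ, p.diag, p.ι,
    ⟨p.isColimit⟩, fun j ↦ hP.le_isCardinalPresentable _ (p.prop_diag_obj j)⟩

section Density

variable {C : Type u} [Category.{v} C] [IsFinitelyAccessibleCategory.{w} C]
  {S : Type w} [SmallCategory S] (ι : S ⥤ C) [IsFinitelyPresentableModel ι]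

include ι in
lemma hom_ext_of_model {X Y : C} {f g : X ⟶ Y}
    (h : ∀ (s : S) (x : ι.obj s ⟶ X), x ≫ f = x ≫ g) : f = g := by
  obtain ⟨J, _, _, D, c, ⟨hc⟩, hD⟩ := exists_isColimit_finitelyPresentable.{w} X
  refine hc.hom_ext fun j ↦ ?_
  obtain ⟨s, ⟨e⟩⟩ := IsFinitelyPresentableModel.exists_iso (ι := ι) (D.obj j) (hD j)
  simpa using e.inv ≫= h s (e.hom ≫ c.app j)

/-- Morphisms can be defined by their effect on morphisms from finitely presented objects. -/
lemma exists_hom_of_natural {X Y : C} (φ : ∀ s, (ι.obj s ⟶ X) → (ι.obj s ⟶ Y))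
    (hφ : ∀ {s t : S} (a : s ⟶ t) (x : ι.obj t ⟶ X), φ s (ι.map a ≫ x) = ι.map a ≫ φ t x) :
    ∃ f : X ⟶ Y, ∀ (s : S) (x : ι.obj s ⟶ X), x ≫ f = φ s x := by
  obtain ⟨J, _, _, D, c, ⟨hc⟩, hD⟩ := exists_isColimit_finitelyPresentable.{w} X
  choose s e using fun j ↦ IsFinitelyPresentableModel.exists_iso (ι := ι) (D.obj j) (hD j)
  replace e := fun j ↦ (e j).some
  let d : Cocone D :=
    { pt := Y
      ι :=
        { app j := (e j).inv ≫ φ _ ((e j).hom ≫ c.app j)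
          naturality j k u := by
            obtain ⟨a, ha⟩ := ι.map_surjective ((e j).hom ≫ D.map u ≫ (e k).inv)
            have := hφ a ((e k).hom ≫ c.app k)
            have hw := c.naturality u
            simp only [Functor.const_obj_obj, Functor.const_obj_map, Category.comp_id] at hw
            simp only [ha, Category.assoc, Iso.inv_hom_id_assoc, hw] at this
            simp [this] } }
  refine ⟨hc.desc d, fun t x ↦ ?_⟩
  obtain ⟨j, y, rfl⟩ := IsFinitelyPresentable.exists_hom_of_isColimit hc x
  obtain ⟨a, ha⟩ := ι.map_surjective (y ≫ (e j).inv)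
  have := hφ a ((e j).hom ≫ c.app j)
  simp only [ha, Category.assoc, Iso.inv_hom_id_assoc] at this
  simp only [Category.assoc, hc.fac]
  simpa [d] using this.symm

/-- `X` is a filtered colimit of finitely presented objects, so the relation `a ≫ x = 0` already
holds at some stage. This replaces cokernels, which need not exist. -/
lemma exists_factor [HasZeroMorphisms C] {X : C} {s t : S} (a : s ⟶ t) (x : ι.obj t ⟶ X)
    (h : ι.map a ≫ x = 0) :
    ∃ (r : S) (c : t ⟶ r) (y : ι.obj r ⟶ X), ι.map c ≫ y = x ∧ ι.map a ≫ ι.map c = 0 := by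
  obtain ⟨J, _, _, D, c, ⟨hc⟩, hD⟩ := exists_isColimit_finitelyPresentable.{w} X
  obtain ⟨j, y, rfl⟩ := IsFinitelyPresentable.exists_hom_of_isColimit hc x
  obtain ⟨k, u, v, huv⟩ := IsFinitelyPresentable.exists_eq_of_isColimit hc (ι.map a ≫ y)
    (0 : ι.obj s ⟶ D.obj j) (by simpa using h)
  obtain ⟨r, ⟨e⟩⟩ := IsFinitelyPresentableModel.exists_iso (ι := ι) (D.obj k) (hD k)
  obtain ⟨b, hb⟩ := ι.map_surjective (y ≫ D.map u ≫ e.inv)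
  refine ⟨r, b, e.hom ≫ c.app k, ?_, ?_⟩
  · have hw := c.naturality u
    simp only [Functor.const_obj_obj, Functor.const_obj_map, Category.comp_id] at hw
    simp [hb, hw]
  · rw [hb, ← Category.assoc, ← Category.assoc, huv]
    simp

end Density

/-! ### Objects as presheaves with filtered category of elements. -/

section Realization

/-- A presheaf of sets, described by its sets of sections. -/
structure SetPresheaf (S : Type w) [SmallCategory S] where
  obj : S → Type v
  map {s t : S} : (s ⟶ t) → obj t → obj s
  map_id {s : S} (x : obj s) : map (𝟙 s) x = x
  map_comp {r s t : S} (a : r ⟶ s) (b : s ⟶ t) (x : obj t) : map (a ≫ b) x = map a (map b x)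

/-- The elements of a presheaf. -/
structure SetPresheaf.Element {S : Type w} [SmallCategory S] (G : SetPresheaf.{w, v} S)
    [∀ s, Small.{w} (G.obj s)] : Type w where
  base : S
  elt : Shrink.{w} (G.obj base)

namespace SetPresheaf

variable {S : Type w} [SmallCategory S] (G : SetPresheaf.{w, v} S) [∀ s, Small.{w} (G.obj s)]

/-- The section underlying an element. -/
noncomputable def Element.val {G : SetPresheaf.{w, v} S} [∀ s, Small.{w} (G.obj s)]
    (x : G.Element) : G.obj x.base :=
  (equivShrink _).symm x.elt

instance : SmallCategory G.Element where
  Hom x y := { a : x.base ⟶ y.base // G.map a y.val = x.val }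
  id x := ⟨𝟙 _, G.map_id _⟩
  comp a b := ⟨a.1 ≫ b.1, by rw [G.map_comp, b.2, a.2]⟩

/-- The functor which sends an element of a presheaf to the object where it lives. -/
def toBase : G.Element ⥤ S where
  obj x := x.base
  map a := a.1

/-- Constructor for elements. -/
noncomputable def mkElement {s : S} (x : G.obj s) : G.Element := ⟨s, equivShrink _ x⟩

lemma mkElement_val {s : S} (x : G.obj s) : (G.mkElement x).val = x :=
  (equivShrink _).symm_apply_apply x

/-- Constructor for morphisms of elements. -/
def homMk {s : S} (x : G.obj s) (y : G.Element) (a : s ⟶ y.base)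
    (h : G.map a y.val = x) : G.mkElement x ⟶ y :=
  ⟨a, h.trans (G.mkElement_val x).symm⟩

variable {C : Type u} [Category.{v} C] [IsFinitelyAccessibleCategory.{w} C]
  (ι : S ⥤ C) [IsFinitelyPresentableModel ι]

/-- A presheaf on the finitely presented objects whose category of elements is filtered
is represented by an object of the category. -/
lemma exists_representation (h₀ : ∃ s, Nonempty (G.obj s))
    (h₁ : ∀ {s t : S} (x : G.obj s) (y : G.obj t), ∃ (r : S) (a : s ⟶ r) (b : t ⟶ r) (z : G.obj r),
      G.map a z = x ∧ G.map b z = y)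
    (h₂ : ∀ {s t : S} (a b : s ⟶ t) (x : G.obj t), G.map a x = G.map b x →
      ∃ (r : S) (c : t ⟶ r) (y : G.obj r), G.map c y = x ∧ a ≫ c = b ≫ c) :
    ∃ (K : C) (e : ∀ s, G.obj s ≃ (ι.obj s ⟶ K)),
      ∀ {s t : S} (a : s ⟶ t) (x : G.obj t), e s (G.map a x) = ι.map a ≫ e t x := by
  have := Cardinal.fact_isRegular_aleph0.{w}
  have : HasFilteredColimitsOfSize.{w, w} C :=
    HasCardinalFilteredColimits_iff_hasFilteredColimitsOfSize.1 inferInstance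
  have : IsFiltered G.Element :=
    { nonempty := h₀.elim fun s ⟨x⟩ ↦ ⟨G.mkElement x⟩
      cocone_objs x y := by
        obtain ⟨r, a, b, z, h, h'⟩ := h₁ x.val y.val
        exact ⟨G.mkElement z, ⟨a, (congrArg _ (G.mkElement_val z)).trans h⟩,
          ⟨b, (congrArg _ (G.mkElement_val z)).trans h'⟩, trivial⟩
      cocone_maps x y a b := by
        obtain ⟨r, c, z, h, h'⟩ := h₂ a.1 b.1 y.val (a.2.trans b.2.symm)
        exact ⟨G.mkElement z, ⟨c, (congrArg _ (G.mkElement_val z)).trans h⟩, Subtype.ext h'⟩ }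
  -- The representing object is the colimit of the canonical diagram over the category of elements.
  let F := G.toBase ⋙ ι
  let e (s : S) (x : G.obj s) : ι.obj s ⟶ colimit F := colimit.ι F (G.mkElement x)
  have he {s : S} (x : G.obj s) (y : G.Element) (a : s ⟶ y.base)
      (h : G.map a y.val = x) : e s x = ι.map a ≫ colimit.ι F y :=
    (colimit.w F (G.homMk x y a h)).symm
  have inj (s : S) : Function.Injective (e s) := by
    intro x y hxy
    obtain ⟨q, u, v, huv⟩ := IsFinitelyPresentable.exists_eq_of_isColimit (colimit.isColimit F)
      (i := G.mkElement x) (j := G.mkElement y) (𝟙 (ι.obj s)) (𝟙 (ι.obj s))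
      ((Category.id_comp _).trans (hxy.trans (Category.id_comp _).symm))
    have huv' : u.1 = v.1 :=
      ι.map_injective ((Category.id_comp _).symm.trans (huv.trans (Category.id_comp _)))
    rw [← G.mkElement_val x, ← G.mkElement_val y]
    exact u.2.symm.trans ((congrArg (fun a : s ⟶ q.base ↦ G.map a q.val) huv').trans v.2)
  have surj (s : S) : Function.Surjective (e s) := by
    intro f
    obtain ⟨y, g, rfl⟩ := IsFinitelyPresentable.exists_hom_of_isColimit (colimit.isColimit F) f
    obtain ⟨a, rfl⟩ := ι.map_surjective (X := s) (Y := y.base) g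
    exact ⟨_, he _ y a rfl⟩
  refine ⟨colimit F, fun s ↦ Equiv.ofBijective (e s) ⟨inj s, surj s⟩, fun a x ↦ ?_⟩
  exact he _ (G.mkElement x) a (congrArg _ (G.mkElement_val x))

end SetPresheaf

end Realization

/-! ### Purity tested on the small model. -/

section

variable {C : Type u} [Category.{v} C] [Preadditive C] [IsFinitelyAccessibleCategory.{w} C]
  {S : Type w} [SmallCategory S] (ι : S ⥤ C) [IsFinitelyPresentableModel ι]

include ι in
-- By density, the kernel and cokernel factorizations can be chosen on each finitely presented
-- object; they are natural because they are unique there.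
lemma isPure_of_model (T : ShortComplex C)
    (inj : ∀ (s : S) (x : ι.obj s ⟶ T.X₁), x ≫ T.f = 0 → x = 0)
    (exact : ∀ (s : S) (x : ι.obj s ⟶ T.X₂), x ≫ T.g = 0 → ∃ y, y ≫ T.f = x)
    (surj : ∀ (s : S) (x : ι.obj s ⟶ T.X₃), ∃ y, y ≫ T.g = x) : IsPure.{w} T := by
  have hmono : Mono T.f := Preadditive.mono_of_cancel_zero _ fun {Y} g hg ↦
    hom_ext_of_model ι fun s x ↦ by
      rw [comp_zero]
      exact inj s _ (by rw [Category.assoc, hg, comp_zero])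
  have hepi : Epi T.g := Preadditive.epi_of_cancel_zero _ fun {Y} g hg ↦
    hom_ext_of_model ι fun s x ↦ by
      obtain ⟨y, rfl⟩ := surj s x
      simp [hg]
  have hker {Y : C} (k : Y ⟶ T.X₂) (hk : k ≫ T.g = 0) : ∃ l : Y ⟶ T.X₁, l ≫ T.f = k := by
    choose φ hφ using fun (s : S) (x : ι.obj s ⟶ Y) ↦
      exact s (x ≫ k) (by rw [Category.assoc, hk, comp_zero])
    obtain ⟨l, hl⟩ := exists_hom_of_natural ι φ fun a x ↦ by
      rw [← cancel_mono T.f, hφ, Category.assoc, Category.assoc, hφ]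
    exact ⟨l, hom_ext_of_model ι fun s x ↦ by rw [← Category.assoc, hl, hφ]⟩
  have hcoker {Y : C} (k : T.X₂ ⟶ Y) (hk : T.f ≫ k = 0) : ∃ l : T.X₃ ⟶ Y, T.g ≫ l = k := by
    have hk' {s : S} (x x' : ι.obj s ⟶ T.X₂) (h : x ≫ T.g = x' ≫ T.g) : x ≫ k = x' ≫ k := by
      obtain ⟨y, hy⟩ := exact s (x - x') (by rw [Preadditive.sub_comp, h, sub_self])
      rw [← sub_eq_zero, ← Preadditive.sub_comp, ← hy, Category.assoc, hk, comp_zero]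
    choose φ hφ using surj
    obtain ⟨l, hl⟩ := exists_hom_of_natural ι (fun s x ↦ φ s x ≫ k) fun a x ↦ by
      rw [← Category.assoc]
      exact hk' _ _ (by rw [hφ, Category.assoc, hφ])
    refine ⟨l, hom_ext_of_model ι fun s x ↦ ?_⟩
    rw [← Category.assoc, hl]
    exact hk' _ _ (hφ _ _)
  exact
    { isKernel := ⟨KernelFork.IsLimit.ofι' _ _ fun k hk ↦
        ⟨(hker k hk).choose, (hker k hk).choose_spec⟩⟩
      isCokernel := ⟨CokernelCofork.IsColimit.ofπ' _ _ fun k hk ↦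
        ⟨(hcoker k hk).choose, (hcoker k hk).choose_spec⟩⟩
      shortExact P hP := by
        obtain ⟨s, ⟨e⟩⟩ := IsFinitelyPresentableModel.exists_iso (ι := ι) P hP
        refine
          { exact := ?_
            mono_f := ?_
            epi_g := ?_ }
        · rw [ShortComplex.ab_exact_iff]
          intro x hx
          exact hker x hx
        · rw [AddCommGrpCat.mono_iff_injective]
          intro x y hxy
          exact (cancel_mono T.f).1 hxy
        · rw [AddCommGrpCat.epi_iff_surjective]
          intro x
          obtain ⟨y, hy⟩ := surj s (e.hom ≫ x)
          refine ⟨e.inv ≫ y, show (e.inv ≫ y) ≫ T.g = x from ?_⟩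
          rw [Category.assoc, hy]
          exact e.inv_hom_id_assoc _ }

omit [IsFinitelyAccessibleCategory.{w} C] in
lemma IsPure.mono {T : ShortComplex C} (hT : IsPure.{w} T) : Mono T.f :=
  mono_of_isLimit_fork hT.isKernel.some

omit [IsFinitelyAccessibleCategory.{w} C] in
lemma IsPure.exists_lift {T : ShortComplex C} (hT : IsPure.{w} T) (P : C)
    [hP : IsFinitelyPresentable.{w} P] (x : P ⟶ T.X₃) : ∃ y, y ≫ T.g = x := by
  have := (hT.shortExact P hP).epi_g
  rw [AddCommGrpCat.epi_iff_surjective] at this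
  exact this x

omit [IsFinitelyAccessibleCategory.{w} C] in
lemma IsPure.exists_lift_of_comp_eq_zero {T : ShortComplex C} (hT : IsPure.{w} T) {P : C}
    (x : P ⟶ T.X₂) (hx : x ≫ T.g = 0) : ∃ y, y ≫ T.f = x :=
  ⟨_, (KernelFork.IsLimit.lift' hT.isKernel.some x hx).2⟩

end

/-! ### Pure subfunctors and their quotients. -/

section

variable {C : Type u} [Category.{v} C] [Preadditive C]
  {S : Type w} [SmallCategory S] (ι : S ⥤ C)

/-- A pure subfunctor of the functor of morphisms from finitely presented objects to `X`. -/
structure PureSubfunctor (X : C) where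
  carrier (s : S) : AddSubgroup (ι.obj s ⟶ X)
  precomp {s t : S} (a : s ⟶ t) {x : ι.obj t ⟶ X} (hx : x ∈ carrier t) :
    ι.map a ≫ x ∈ carrier s
  pure {s t : S} (a : s ⟶ t) {x : ι.obj t ⟶ X} (hx : ι.map a ≫ x ∈ carrier s) :
    ∃ y ∈ carrier t, ι.map a ≫ y = ι.map a ≫ x

variable {ι}

/-- A pure short exact sequence defines a pure subfunctor. -/
def IsPure.pureSubfunctor [IsFinitelyAccessibleCategory.{w} C] [IsFinitelyPresentableModel ι]
    {T : ShortComplex C} (hT : IsPure.{w} T) : PureSubfunctor ι T.X₂ where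
  carrier s := (Preadditive.rightComp (ι.obj s) T.f).range
  precomp {s t} a x hx := by
    obtain ⟨y, rfl⟩ := hx
    exact ⟨ι.map a ≫ y, Category.assoc _ _ _⟩
  pure {s t} a x hx := by
    obtain ⟨k, hk⟩ := hx
    change k ≫ T.f = _ at hk
    -- The image of `x` in the quotient is killed by `a`, so it factors through some `c` with `a ≫ c
    -- = 0`. Lifting the other factor to `z`, the correction `x - c ≫ z` lies in the subobject and
    -- has the same composite with `a`.
    obtain ⟨r, c, y, hy, hc⟩ := exists_factor ι a (x ≫ T.g) (by
      rw [← Category.assoc, ← hk, Category.assoc, T.zero, comp_zero])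
    obtain ⟨z, rfl⟩ := hT.exists_lift _ y
    obtain ⟨l, hl⟩ := hT.exists_lift_of_comp_eq_zero (x - ι.map c ≫ z) (by
      rw [Preadditive.sub_comp, Category.assoc, hy, sub_self])
    refine ⟨x - ι.map c ≫ z, ⟨l, hl⟩, ?_⟩
    rw [Preadditive.comp_sub, ← Category.assoc _ _ z, hc, zero_comp, sub_zero]

namespace PureSubfunctor

variable {X : C} (F : PureSubfunctor ι X)

/-- The presheaf of elements of a pure subfunctor. -/
def toPresheaf : SetPresheaf.{w, v} S where
  obj s := F.carrier s
  map a x := ⟨ι.map a ≫ x.1, F.precomp a x.2⟩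
  map_id x := Subtype.ext (by simp)
  map_comp a b x := Subtype.ext (by simp)

/-- The quotient by a pure subfunctor. -/
def quotient : SetPresheaf.{w, v} S where
  obj s := (ι.obj s ⟶ X) ⧸ F.carrier s
  map a := QuotientAddGroup.map _ _ (Preadditive.leftComp X (ι.map a)) fun _ hx ↦ F.precomp a hx
  map_id x := by
    induction x using QuotientAddGroup.induction_on with | H x =>
    exact congrArg _ (show ι.map (𝟙 _) ≫ x = x by simp)
  map_comp a b x := by
    induction x using QuotientAddGroup.induction_on with | H x =>
    exact congrArg _ (show ι.map (a ≫ b) ≫ x = ι.map a ≫ ι.map b ≫ x by simp)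

/-- The projection to the quotient. -/
def toQuotient (s : S) (x : ι.obj s ⟶ X) : F.quotient.obj s :=
  (x : (ι.obj s ⟶ X) ⧸ F.carrier s)

lemma toQuotient_surjective (s : S) : Function.Surjective (F.toQuotient s) :=
  QuotientAddGroup.mk_surjective

lemma toQuotient_eq_iff {s : S} (x y : ι.obj s ⟶ X) :
    F.toQuotient s x = F.toQuotient s y ↔ x - y ∈ F.carrier s :=
  QuotientAddGroup.eq_iff_sub_mem

lemma quotient_map_toQuotient {s t : S} (a : s ⟶ t) (x : ι.obj t ⟶ X) :
    F.quotient.map a (F.toQuotient t x) = F.toQuotient s (ι.map a ≫ x) := rfl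

end PureSubfunctor

end

/-! ### Pure subfunctors come from pure monomorphisms. -/

section

variable {C : Type u} [Category.{v} C] [Preadditive C] [IsFinitelyAccessibleCategory.{w} C]
  {S : Type w} [SmallCategory S] {ι : S ⥤ C} [IsFinitelyPresentableModel ι]

lemma isFinitelyPresentable_biprod (P Q : C) [HasBinaryBiproduct P Q] [IsFinitelyPresentable.{w} P]
    [IsFinitelyPresentable.{w} Q] : IsFinitelyPresentable.{w} (P ⊞ Q) := by
  have := Cardinal.fact_isRegular_aleph0.{w}
  have (j : Discrete WalkingPair) : IsCardinalPresentable ((pair P Q).obj j) Cardinal.aleph0.{w} := by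
    obtain ⟨_ | _⟩ := j
    · assumption
    · assumption
  exact isCardinalPresentable_of_isColimit _ (BinaryBiproduct.isColimit P Q) Cardinal.aleph0.{w}
    ((hasCardinalLT_aleph0_iff _).2 inferInstance)

variable (ι) in
omit [Preadditive C] in
include ι in
lemma nonempty_of_model (X : C) : Nonempty S := by
  obtain ⟨J, _, _, D, -, -, hD⟩ := exists_isColimit_finitelyPresentable.{w} X
  have : Nonempty J := IsFiltered.nonempty
  exact ⟨(IsFinitelyPresentableModel.exists_iso (ι := ι) (D.obj (Classical.arbitrary J))
    (hD _)).choose⟩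

lemma exists_biprod [HasFiniteBiproducts C] (s t : S) :
    ∃ (r : S) (a : s ⟶ r) (b : t ⟶ r) (p : r ⟶ s) (q : r ⟶ t),
      ι.map a ≫ ι.map p = 𝟙 _ ∧ ι.map a ≫ ι.map q = 0 ∧ ι.map b ≫ ι.map p = 0 ∧
        ι.map b ≫ ι.map q = 𝟙 _ := by
  have := hasBinaryBiproducts_of_finite_biproducts C
  obtain ⟨r, ⟨e⟩⟩ := IsFinitelyPresentableModel.exists_iso (ι := ι) (ι.obj s ⊞ ι.obj t)
    (isFinitelyPresentable_biprod _ _)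
  refine ⟨r, ι.preimage (biprod.inl ≫ e.inv), ι.preimage (biprod.inr ≫ e.inv),
    ι.preimage (e.hom ≫ biprod.fst), ι.preimage (e.hom ≫ biprod.snd), ?_⟩
  simp

/-- Two morphisms from finitely presented objects factor through a common one. -/
lemma exists_common_factor [HasFiniteBiproducts C] {X : C} {s t : S}
    (x : ι.obj s ⟶ X) (y : ι.obj t ⟶ X) :
    ∃ (r : S) (a : s ⟶ r) (b : t ⟶ r) (p : r ⟶ s) (q : r ⟶ t),
      ι.map a ≫ (ι.map p ≫ x + ι.map q ≫ y) = x ∧ ι.map b ≫ (ι.map p ≫ x + ι.map q ≫ y) = y := by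
  obtain ⟨r, a, b, p, q, h₁, h₂, h₃, h₄⟩ := exists_biprod (ι := ι) s t
  refine ⟨r, a, b, p, q, ?_, ?_⟩
  · rw [Preadditive.comp_add, ← Category.assoc, ← Category.assoc, h₁, h₂]; simp
  · rw [Preadditive.comp_add, ← Category.assoc, ← Category.assoc, h₃, h₄]; simp

lemma exists_factor_of_comp_eq {X : C} {s t : S} (a b : s ⟶ t) (x : ι.obj t ⟶ X)
    (h : ι.map a ≫ x = ι.map b ≫ x) :
    ∃ (r : S) (c : t ⟶ r) (y : ι.obj r ⟶ X), ι.map c ≫ y = x ∧ a ≫ c = b ≫ c := by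
  obtain ⟨d, hd⟩ := ι.map_surjective (ι.map a - ι.map b)
  obtain ⟨r, c, y, hy, hc⟩ := exists_factor ι d x (by
    rw [hd, Preadditive.sub_comp, h, sub_self])
  refine ⟨r, c, y, hy, ι.map_injective ?_⟩
  rwa [ι.map_comp, ι.map_comp, ← sub_eq_zero, ← Preadditive.sub_comp, ← hd]

namespace PureSubfunctor

variable [HasFiniteBiproducts C] {X : C} (F : PureSubfunctor ι X)

/-- A pure subfunctor is represented by an object. -/
lemma exists_representation : ∃ (K : C) (i : K ⟶ X),
    (∀ (s : S) (x : ι.obj s ⟶ X), x ∈ F.carrier s ↔ ∃ y, y ≫ i = x) ∧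
      ∀ (s : S) (x y : ι.obj s ⟶ K), x ≫ i = y ≫ i → x = y := by
  have := Cardinal.fact_isRegular_aleph0.{w}
  have : LocallySmall.{w} C := inferInstance
  have (s : S) : Small.{w} (F.toPresheaf.obj s) :=
    inferInstanceAs (Small.{w} { x // x ∈ F.carrier s })
  obtain ⟨s₀⟩ := nonempty_of_model ι X
  obtain ⟨K, e, he⟩ := F.toPresheaf.exists_representation ι ⟨s₀, ⟨⟨0, zero_mem _⟩⟩⟩ (by
      rintro s t ⟨x, hx⟩ ⟨y, hy⟩
      obtain ⟨r, a, b, p, q, h, h'⟩ := exists_common_factor x y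
      exact ⟨r, a, b, ⟨_, add_mem (F.precomp p hx) (F.precomp q hy)⟩, Subtype.ext h,
        Subtype.ext h'⟩) (by
      rintro s t a b ⟨x, hx⟩ h
      obtain ⟨r, c, y, hy, hc⟩ := exists_factor_of_comp_eq a b x (congrArg Subtype.val h)
      -- The factor `y` need not lie in `F`; purity replaces it by one that does.
      obtain ⟨z, hz, hz'⟩ := F.pure c (x := y) (hy ▸ hx)
      exact ⟨r, c, ⟨z, hz⟩, Subtype.ext (hz'.trans hy), hc⟩)
  obtain ⟨i, hi⟩ := exists_hom_of_natural ι (X := K) (Y := X) (fun s x ↦ ((e s).symm x).1)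
    fun {s t} a x ↦ by
      obtain ⟨x, rfl⟩ := (e t).surjective x
      rw [← he, (e s).symm_apply_apply, (e t).symm_apply_apply]
      rfl
  refine ⟨K, i, fun s x ↦ ⟨fun hx ↦ ⟨e s ⟨x, hx⟩, ?_⟩, ?_⟩, fun s x y h ↦ ?_⟩
  · rw [hi]
    exact congrArg Subtype.val ((e s).symm_apply_apply _)
  · rintro ⟨y, rfl⟩
    rw [hi]
    exact ((e s).symm y).2
  · rw [hi, hi] at h
    exact (e s).symm.injective (Subtype.ext h)

/-- The quotient by a pure subfunctor is represented by an object. -/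
lemma exists_representation_quotient : ∃ (L : C) (p : X ⟶ L),
    (∀ (s : S) (x : ι.obj s ⟶ X), x ∈ F.carrier s ↔ x ≫ p = 0) ∧
      ∀ (s : S) (x : ι.obj s ⟶ L), ∃ y, y ≫ p = x := by
  have := Cardinal.fact_isRegular_aleph0.{w}
  have : LocallySmall.{w} C := inferInstance
  have (s : S) : Small.{w} (F.quotient.obj s) := small_of_surjective (F.toQuotient_surjective s)
  obtain ⟨s₀⟩ := nonempty_of_model ι X
  obtain ⟨L, e, he⟩ := F.quotient.exists_representation ι ⟨s₀, ⟨F.toQuotient _ 0⟩⟩ (by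
      intro s t x y
      obtain ⟨x, rfl⟩ := F.toQuotient_surjective s x
      obtain ⟨y, rfl⟩ := F.toQuotient_surjective t y
      obtain ⟨r, a, b, p, q, h, h'⟩ := exists_common_factor x y
      exact ⟨r, a, b, F.toQuotient _ _, congrArg (F.toQuotient _) h,
        congrArg (F.toQuotient _) h'⟩) (by
      intro s t a b x h
      obtain ⟨x, rfl⟩ := F.toQuotient_surjective t x
      obtain ⟨d, hd⟩ := ι.map_surjective (ι.map a - ι.map b)
      rw [quotient_map_toQuotient, quotient_map_toQuotient, toQuotient_eq_iff,
        ← Preadditive.sub_comp, ← hd] at h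
      -- Equality in the quotient only gives `(a - b) ≫ x ∈ F`. Purity yields `f ∈ F` such that `a`
      -- and `b` genuinely agree on `x - f`, another representative of the same class.
      obtain ⟨f, hf, hf'⟩ := F.pure d h
      obtain ⟨r, c, y, hy, hc⟩ := exists_factor_of_comp_eq a b (x - f) (by
        rw [← sub_eq_zero, ← Preadditive.sub_comp, ← hd, Preadditive.comp_sub, hf', sub_self])
      refine ⟨r, c, F.toQuotient _ y, ?_, hc⟩
      rw [quotient_map_toQuotient, hy, toQuotient_eq_iff]
      simpa using hf)
  obtain ⟨p, hp⟩ := exists_hom_of_natural ι (X := X) (Y := L) (fun s x ↦ e s (F.toQuotient s x))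
    fun {s t} a x ↦ by rw [← he, quotient_map_toQuotient]
  refine ⟨L, p, fun s x ↦ ?_, fun s x ↦ ?_⟩
  · rw [← zero_comp (f := p), hp, hp, (e s).apply_eq_iff_eq, toQuotient_eq_iff, sub_zero]
  · obtain ⟨y, rfl⟩ := (e s).surjective x
    obtain ⟨y, rfl⟩ := F.toQuotient_surjective s y
    exact ⟨y, hp s y⟩

/-- A pure subfunctor comes from a pure monomorphism. -/
lemma exists_isPureMono : ∃ (K : C) (i : K ⟶ X), IsPureMono.{w} i ∧
    ∀ (s : S) (x : ι.obj s ⟶ X), x ∈ F.carrier s ↔ ∃ y, y ≫ i = x := by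
  obtain ⟨K, i, hi, inj⟩ := F.exists_representation
  obtain ⟨L, p, hp, surj⟩ := F.exists_representation_quotient
  have zero : i ≫ p = 0 := hom_ext_of_model ι fun s x ↦ by
    rw [comp_zero, ← Category.assoc, ← hp, hi]
    exact ⟨x, rfl⟩
  exact ⟨K, i, ⟨L, p, zero, isPure_of_model ι _
    (fun s x hx ↦ inj s x 0 (hx.trans zero_comp.symm))
    (fun s x hx ↦ (hi s x).1 ((hp s x).2 hx)) surj⟩, hi⟩

end PureSubfunctor

end

/-! ### Morphisms from finitely presented objects to coproducts. -/

section Coproduct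

variable {C : Type u} [Category.{v} C] [Preadditive C] [HasFiniteBiproducts C]

lemma comp_eq_sum_coproduct {I : Type*} [Fintype I] (f : I → C) {Z W : C} (y : Z ⟶ ∐ f)
    (z : ∐ f ⟶ W) :
    y ≫ z = ∑ j, (y ≫ Sigma.desc (biproduct.ι f) ≫ biproduct.π f j) ≫ Sigma.ι f j ≫ z := by
  classical
  have h : z = ∑ j, (Sigma.desc (biproduct.ι f) ≫ biproduct.π f j) ≫ Sigma.ι f j ≫ z := by
    refine Sigma.hom_ext _ _ fun k ↦ ?_
    rw [Preadditive.comp_sum, Finset.sum_eq_single k]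
    · simp
    · intro j _ hj
      simp [biproduct.ι_π_ne_assoc f hj.symm]
    · simp
  conv_lhs => rw [h, Preadditive.comp_sum]
  simp only [Category.assoc]

variable [IsFinitelyAccessibleCategory.{w} C]
  {S : Type w} [SmallCategory S] {ι : S ⥤ C} [IsFinitelyPresentableModel ι]

/-- The coprojections generate: a morphism from a finitely presented object factors through a finite
subcoproduct, hence is a finite sum of multiples of coprojections. -/
lemma mem_of_ι_mem {I : Type w} (σ : I → S) [HasCoproduct fun i ↦ ι.obj (σ i)]
    (A : ∀ s, AddSubgroup (ι.obj s ⟶ ∐ fun i ↦ ι.obj (σ i)))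
    (precomp : ∀ {s t : S} (a : s ⟶ t) (x : ι.obj t ⟶ ∐ fun i ↦ ι.obj (σ i)),
      x ∈ A t → ι.map a ≫ x ∈ A s)
    (hA : ∀ i, Sigma.ι (fun i ↦ ι.obj (σ i)) i ∈ A (σ i)) (s : S)
    (x : ι.obj s ⟶ ∐ fun i ↦ ι.obj (σ i)) : x ∈ A s := by
  have := Cardinal.fact_isRegular_aleph0.{w}
  have : HasFilteredColimitsOfSize.{w, w} C :=
    HasCardinalFilteredColimits_iff_hasFilteredColimitsOfSize.1 inferInstance
  obtain ⟨T, y, rfl⟩ := IsFinitelyPresentable.exists_hom_of_isColimit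
    (CoproductsFromFiniteFiltered.isColimitFiniteSubproductsCocone fun i ↦ ι.obj (σ i)) x
  have h := comp_eq_sum_coproduct (fun x : T ↦ ι.obj (σ x.1.as)) y
    ((CoproductsFromFiniteFiltered.finiteSubcoproductsCocone fun i ↦ ι.obj (σ i)).ι.app T)
  refine (congrArg (· ∈ A s) h).mpr (sum_mem fun j _ ↦ ?_)
  obtain ⟨a, ha⟩ := ι.map_surjective (X := s) (Y := σ j.1.as)
    (y ≫ Sigma.desc (biproduct.ι fun x : T ↦ ι.obj (σ x.1.as)) ≫
      biproduct.π (fun x : T ↦ ι.obj (σ x.1.as)) j)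
  have hj : Sigma.ι (fun x : T ↦ ι.obj (σ x.1.as)) j ≫
      (CoproductsFromFiniteFiltered.finiteSubcoproductsCocone fun i ↦ ι.obj (σ i)).ι.app T =
        Sigma.ι (fun i ↦ ι.obj (σ i)) j.1.as :=
    Sigma.ι_desc _ _
  have key := precomp a _ (hA j.1.as)
  rw [ha, ← hj] at key
  exact key

end Coproduct

/-! ### Formal expressions and the enlargement of a pure subfunctor. -/

/-- Formal expressions: they are obtained from generators using additions, the action of
morphisms and formal divisions by morphisms. -/
inductive FormalExpr (S : Type w) [SmallCategory S] : S → Type w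
  | gen (s : S) : FormalExpr S s
  | add {s : S} : FormalExpr S s → FormalExpr S s → FormalExpr S s
  | precomp {s t : S} (a : s ⟶ t) : FormalExpr S t → FormalExpr S s
  | div {s t : S} (a : s ⟶ t) : FormalExpr S s → FormalExpr S t

namespace PureSubfunctor

variable {C : Type u} [Category.{v} C] [Preadditive C]
  {S : Type w} [SmallCategory S] {ι : S ⥤ C} {X : C} (F : PureSubfunctor ι X)
  (x₀ : ∀ s, ι.obj s ⟶ X)

open Classical in
/-- The value of a formal expression: formal divisions are solved modulo the subfunctor `F`. -/
noncomputable def eval : ∀ {s : S}, FormalExpr S s → (ι.obj s ⟶ X)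
  | _, .gen s => x₀ s
  | _, .add e e' => eval e + eval e'
  | _, .precomp a e => ι.map a ≫ eval e
  | s, .div (s := r) a e =>
      -- The value 0 is a harmless default: purity only concerns divisions that have a solution.
      if h : ∃ x : ι.obj s ⟶ X, ι.map a ≫ x - eval e ∈ F.carrier r then h.choose else 0

lemma eval_div {s t : S} (a : s ⟶ t) (e : FormalExpr S s) (x : ι.obj t ⟶ X)
    (hx : ι.map a ≫ x - F.eval x₀ e ∈ F.carrier s) :
    ι.map a ≫ F.eval x₀ (.div a e) - F.eval x₀ e ∈ F.carrier s := by
  have h : ∃ x : ι.obj t ⟶ X, ι.map a ≫ x - F.eval x₀ e ∈ F.carrier s := ⟨x, hx⟩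
  rw [eval.eq_4, dif_pos h]
  exact h.choose_spec

variable [ι.Full]

/-- The subgroup of the values of the formal expressions. -/
def values (s : S) : AddSubgroup (ι.obj s ⟶ X) where
  carrier := Set.range fun e : FormalExpr S s ↦ F.eval x₀ e
  add_mem' := by
    rintro _ _ ⟨e, rfl⟩ ⟨e', rfl⟩
    exact ⟨.add e e', rfl⟩
  zero_mem' := ⟨.precomp (ι.preimage 0) (.gen s), by simp [eval]⟩
  neg_mem' := by
    rintro _ ⟨e, rfl⟩
    exact ⟨.precomp (ι.preimage (-𝟙 _)) e, by simp [eval]⟩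

/-- The enlargement of a pure subfunctor by the values of the formal expressions. -/
def enlarge : PureSubfunctor ι X where
  carrier s := F.carrier s ⊔ F.values x₀ s
  precomp {s t} a x hx := by
    obtain ⟨f, hf, _, ⟨e, rfl⟩, rfl⟩ := AddSubgroup.mem_sup.1 hx
    exact AddSubgroup.mem_sup.2 ⟨_, F.precomp a hf, _, ⟨.precomp a e, rfl⟩,
      (Preadditive.comp_add ..).symm⟩
  pure {s t} a x hx := by
    obtain ⟨f, hf, _, ⟨e, rfl⟩, h⟩ := AddSubgroup.mem_sup.1 hx
    dsimp only at h
    -- Here `x` itself solves the division modulo `F`, so the chosen solution differs from `x` by an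
    -- element whose composite with `a` is in `F`; purity of `F` then corrects the difference.
    have hd := F.eval_div x₀ a e x (by rw [← h]; simpa using hf)
    obtain ⟨g, hg, hg'⟩ := F.pure a (x := x - F.eval x₀ (.div a e)) (by
      rw [Preadditive.comp_sub, ← h]
      convert sub_mem hf hd using 1
      abel)
    exact ⟨g + F.eval x₀ (.div a e), AddSubgroup.mem_sup.2 ⟨g, hg, _, ⟨_, rfl⟩, rfl⟩, by
      rw [Preadditive.comp_add, hg', ← Preadditive.comp_add, sub_add_cancel]⟩

lemma mem_enlarge_iff {s : S} (x : ι.obj s ⟶ X) :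
    x ∈ (F.enlarge x₀).carrier s ↔ ∃ f ∈ F.carrier s, ∃ e, f + F.eval x₀ e = x := by
  refine AddSubgroup.mem_sup.trans ⟨?_, ?_⟩
  · rintro ⟨f, hf, _, ⟨e, rfl⟩, h⟩
    exact ⟨f, hf, e, h⟩
  · rintro ⟨f, hf, e, h⟩
    exact ⟨f, hf, _, ⟨e, rfl⟩, h⟩

end PureSubfunctor

/-! ### Extension of partial morphisms and Zorn's lemma. -/

section Extension

variable {C : Type u} [Category.{v} C] [Preadditive C]
  {S : Type w} [SmallCategory S] (ι : S ⥤ C) {X M : C}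

/-- Graphs of the natural transformations from a pure subfunctor of the functor of morphisms from
finitely presented objects to `X`, with values in the functor of morphisms to `M`. -/
structure IsPartialHom (Γ : ∀ s, AddSubgroup ((ι.obj s ⟶ X) × (ι.obj s ⟶ M))) : Prop where
  precomp {s t : S} (a : s ⟶ t) {x : ι.obj t ⟶ X} {m : ι.obj t ⟶ M} (h : (x, m) ∈ Γ t) :
    (ι.map a ≫ x, ι.map a ≫ m) ∈ Γ s
  eq_zero {s : S} {m : ι.obj s ⟶ M} (h : (0, m) ∈ Γ s) : m = 0
  pure {s t : S} (a : s ⟶ t) {x : ι.obj t ⟶ X} {m : ι.obj s ⟶ M} (h : (ι.map a ≫ x, m) ∈ Γ s) :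
    ∃ y n, (y, n) ∈ Γ t ∧ ι.map a ≫ y = ι.map a ≫ x

namespace IsPartialHom

variable {ι} {Γ : ∀ s, AddSubgroup ((ι.obj s ⟶ X) × (ι.obj s ⟶ M))} (hΓ : IsPartialHom ι Γ)

/-- The domain of definition. -/
def domain : PureSubfunctor ι X where
  carrier s := (Γ s).map (AddMonoidHom.fst _ _)
  precomp a x hx := by
    obtain ⟨⟨x, m⟩, h, rfl⟩ := hx
    exact ⟨_, hΓ.precomp a h, rfl⟩
  pure a x hx := by
    obtain ⟨⟨z, m⟩, h, rfl : z = _⟩ := hx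
    obtain ⟨y, n, h, h'⟩ := hΓ.pure a h
    exact ⟨y, ⟨_, h, rfl⟩, h'⟩

lemma mem_domain_iff {s : S} (x : ι.obj s ⟶ X) :
    x ∈ hΓ.domain.carrier s ↔ ∃ m, (x, m) ∈ Γ s := by
  constructor
  · rintro ⟨⟨x, m⟩, h, rfl⟩
    exact ⟨m, h⟩
  · rintro ⟨m, h⟩
    exact ⟨_, h, rfl⟩

include hΓ in
lemma unique {s : S} {x : ι.obj s ⟶ X} {m n : ι.obj s ⟶ M} (hm : (x, m) ∈ Γ s)
    (hn : (x, n) ∈ Γ s) : m = n := by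
  rw [← sub_eq_zero]
  apply hΓ.eq_zero
  simpa using sub_mem hm hn

variable [HasFiniteBiproducts C] [IsFinitelyAccessibleCategory.{w} C]
  [IsFinitelyPresentableModel ι]

include hΓ in
lemma exists_extension
    (hM : ∀ G : C, directSumsOfFinitelyPresented C (Cardinal.mk (Σ s : S, FormalExpr S s)) G →
      IsPureInjectiveRel.{w} M G) (x₀ : ∀ s, ι.obj s ⟶ X) :
    ∃ Γ' : ∀ s, AddSubgroup ((ι.obj s ⟶ X) × (ι.obj s ⟶ M)), IsPartialHom ι Γ' ∧ Γ ≤ Γ' ∧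
      ∀ s, ∃ m, (x₀ s, m) ∈ Γ' s := by
  have := Cardinal.fact_isRegular_aleph0.{w}
  have : HasFilteredColimitsOfSize.{w, w} C :=
    HasCardinalFilteredColimits_iff_hasFilteredColimitsOfSize.1 inferInstance
  have : HasCoproducts.{w} C := hasCoproducts_of_finite_and_filtered
  let F := hΓ.domain
  let obj (i : Σ s : S, FormalExpr S s) : C := ι.obj i.1
  let π : ∐ obj ⟶ X := Sigma.desc fun i ↦ F.eval x₀ i.2
  have ι_π {s : S} (e : FormalExpr S s) : Sigma.ι obj ⟨s, e⟩ ≫ π = F.eval x₀ e :=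
    Sigma.ι_desc _ _
  have comp_π_mem {s : S} (y : ι.obj s ⟶ ∐ obj) : y ≫ π ∈ F.values x₀ s := by
    refine mem_of_ι_mem (ι := ι) (fun i : Σ s : S, FormalExpr S s ↦ i.1)
      (fun s ↦ (F.values x₀ s).comap (Preadditive.rightComp (ι.obj s) π)) ?_ ?_ s y
    · rintro s t a x ⟨e, he⟩
      exact ⟨.precomp a e, (ι.map a ≫= he).trans (Category.assoc _ _ _).symm⟩
    · rintro ⟨s, e⟩
      exact ⟨e, (ι_π e).symm⟩
  let N : PureSubfunctor ι (∐ obj) :=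
    { carrier s := (F.carrier s).comap (Preadditive.rightComp (ι.obj s) π)
      precomp {s t} a x hx := by
        change (ι.map a ≫ x) ≫ π ∈ F.carrier s
        rw [Category.assoc]
        exact F.precomp a hx
      pure {s t} a y hy := by
        change (ι.map a ≫ y) ≫ π ∈ F.carrier s at hy
        rw [Category.assoc] at hy
        obtain ⟨f, hf, hf'⟩ := F.pure a hy
        -- The element `y ≫ π - f` is killed by `a`, so it factors through some `c` with `a ≫ c =
        -- 0`. Purity of the enlargement lets the other factor be taken as `f' + eval e`.
        -- Subtracting `c` followed by the coprojection of `e` from `y` keeps the composite with `a`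
        -- and moves the image under `π` into `F`.
        have hmem : y ≫ π - f ∈ (F.enlarge x₀).carrier t :=
          sub_mem (AddSubgroup.mem_sup_right (comp_π_mem y)) (AddSubgroup.mem_sup_left hf)
        obtain ⟨r, c, z, hz, hc⟩ := exists_factor ι a (y ≫ π - f) (by
          rw [Preadditive.comp_sub, hf', sub_self])
        obtain ⟨g, hg, hg'⟩ := (F.enlarge x₀).pure c (x := z) (hz ▸ hmem)
        obtain ⟨f', hf', e, rfl⟩ := (F.mem_enlarge_iff x₀ g).1 hg
        refine ⟨y - ι.map c ≫ Sigma.ι obj ⟨r, e⟩, ?_, ?_⟩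
        · change (y - ι.map c ≫ Sigma.ι obj ⟨r, e⟩) ≫ π ∈ F.carrier t
          rw [hz, Preadditive.comp_add] at hg'
          rw [Preadditive.sub_comp, Category.assoc, ι_π]
          convert add_mem hf (F.precomp c hf') using 1
          rw [sub_eq_iff_eq_add, add_assoc, hg']
          abel
        · rw [Preadditive.comp_sub, ← Category.assoc _ (ι.map c), hc, zero_comp, sub_zero] }
  obtain ⟨K, i, hi, mem_iff⟩ := N.exists_isPureMono
  -- On the preimage `K` of `F`, the partial morphism is composed with `π`; uniqueness of values
  -- makes this natural.
  choose φ hφ using fun (s : S) (z : ι.obj s ⟶ K) ↦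
    (hΓ.mem_domain_iff ((z ≫ i) ≫ π)).1 ((mem_iff s (z ≫ i)).2 ⟨z, rfl⟩)
  obtain ⟨k, hk⟩ := exists_hom_of_natural ι φ fun {s t} a z ↦ by
    refine hΓ.unique (hφ _ _) ?_
    simpa using hΓ.precomp a (hφ t z)
  obtain ⟨g, rfl⟩ := hM (∐ obj) ⟨_, obj, Sigma.ι obj, le_rfl, fun i ↦ inferInstance,
    ⟨coproductIsCoproduct obj⟩⟩ i hi k
  have comp_mem {s : S} (y : ι.obj s ⟶ ∐ obj) (hy : y ≫ π ∈ F.carrier s) :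
      (y ≫ π, y ≫ g) ∈ Γ s := by
    obtain ⟨z, rfl⟩ := (mem_iff s y).1 hy
    rw [Category.assoc z i g, hk]
    exact hφ s z
  let Δ (s : S) : AddSubgroup ((ι.obj s ⟶ X) × (ι.obj s ⟶ M)) :=
    ((Preadditive.rightComp (ι.obj s) π).prod (Preadditive.rightComp (ι.obj s) g)).range
  have mem_Δ {s : S} (y : ι.obj s ⟶ ∐ obj) : (y ≫ π, y ≫ g) ∈ Δ s := ⟨y, rfl⟩
  have mem_Δ_gen {s : S} (e : FormalExpr S s) :
      (F.eval x₀ e, Sigma.ι obj ⟨s, e⟩ ≫ g) ∈ Δ s :=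
    ⟨Sigma.ι obj ⟨s, e⟩, Prod.ext (ι_π e) rfl⟩
  refine ⟨fun s ↦ Γ s ⊔ Δ s, ⟨?_, ?_, ?_⟩, fun s ↦ le_sup_left, fun s ↦
    ⟨_, AddSubgroup.mem_sup_right (mem_Δ_gen (.gen s))⟩⟩
  · intro s t a x m h
    obtain ⟨⟨x', n⟩, hx, _, ⟨y, rfl⟩, h'⟩ := AddSubgroup.mem_sup.1 h
    obtain ⟨rfl, rfl⟩ := Prod.ext_iff.1 h'
    refine AddSubgroup.mem_sup.2 ⟨_, hΓ.precomp a hx, _, mem_Δ (ι.map a ≫ y), ?_⟩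
    simp only [Category.assoc, Prod.mk_add_mk, ← Preadditive.comp_add]
    rfl
  · intro s m h
    obtain ⟨⟨x, n⟩, h, _, ⟨y, rfl⟩, h'⟩ := AddSubgroup.mem_sup.1 h
    have hx : x + y ≫ π = 0 := congrArg Prod.fst h'
    -- If the first coordinates cancel, then `y ≫ π` lies in `F`, so `(y ≫ π, y ≫ g)` is already in
    -- `Γ`.
    refine hΓ.eq_zero (h' ▸ add_mem h (comp_mem y ?_))
    rw [eq_neg_of_add_eq_zero_right hx]
    exact neg_mem ((hΓ.mem_domain_iff x).2 ⟨n, h⟩)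
  · intro s t a x m h
    obtain ⟨⟨x', n⟩, h, _, ⟨y, rfl⟩, h'⟩ := AddSubgroup.mem_sup.1 h
    have hx : x' + y ≫ π = ι.map a ≫ x := congrArg Prod.fst h'
    obtain ⟨z, hz, hz'⟩ := (F.enlarge x₀).pure a (x := x) (hx ▸
      add_mem (AddSubgroup.mem_sup_left ((hΓ.mem_domain_iff x').2 ⟨n, h⟩))
        (AddSubgroup.mem_sup_right (comp_π_mem y)))
    obtain ⟨f, hf, e, rfl⟩ := (F.mem_enlarge_iff x₀ z).1 hz
    obtain ⟨n', hn'⟩ := (hΓ.mem_domain_iff f).1 hf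
    exact ⟨_, _, AddSubgroup.mem_sup.2 ⟨_, hn', _, mem_Δ_gen e, rfl⟩, hz'⟩

end IsPartialHom

/-- The supremum of a chain is its pointwise union, and each condition involves a single element of
a graph. -/
lemma isPartialHom_sSup {c : Set (∀ s, AddSubgroup ((ι.obj s ⟶ X) × (ι.obj s ⟶ M)))}
    (hc : ∀ Γ ∈ c, IsPartialHom ι Γ) (hc' : IsChain (· ≤ ·) c) (hc'' : c.Nonempty) :
    IsPartialHom ι (sSup c) := by
  have : Nonempty c := hc''.to_subtype
  have mem_iff {s : S} (x) : x ∈ (sSup c) s ↔ ∃ Γ ∈ c, x ∈ Γ s := by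
    rw [sSup_apply, AddSubgroup.mem_iSup_of_directed]
    · simp
    · exact hc'.directed.mono_comp (g := fun (Γ : ∀ s, AddSubgroup _) ↦ Γ s) (· ≤ ·)
        fun _ _ h ↦ h s
  constructor
  · intro s t a x m h
    obtain ⟨Γ, hΓ, h⟩ := (mem_iff _).1 h
    exact (mem_iff _).2 ⟨Γ, hΓ, (hc Γ hΓ).precomp a h⟩
  · intro s m h
    obtain ⟨Γ, hΓ, h⟩ := (mem_iff _).1 h
    exact (hc Γ hΓ).eq_zero h
  · intro s t a x m h
    obtain ⟨Γ, hΓ, h⟩ := (mem_iff _).1 h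
    obtain ⟨y, n, h, h'⟩ := (hc Γ hΓ).pure a h
    exact ⟨y, n, (mem_iff _).2 ⟨Γ, hΓ, h⟩, h'⟩

variable {ι} [IsFinitelyAccessibleCategory.{w} C] [IsFinitelyPresentableModel ι]

lemma isPartialHom_of_isPure {T : ShortComplex C} (hT : IsPure.{w} T) (f : T.X₁ ⟶ M) :
    IsPartialHom ι fun s ↦
      ((Preadditive.rightComp (ι.obj s) T.f).prod (Preadditive.rightComp (ι.obj s) f)).range := by
  have := hT.mono
  constructor
  · rintro s t a x m ⟨k, hk⟩
    obtain ⟨rfl, rfl⟩ := Prod.ext_iff.1 hk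
    exact ⟨ι.map a ≫ k, Prod.ext (Category.assoc _ _ _) (Category.assoc _ _ _)⟩
  · rintro s m ⟨k, hk⟩
    obtain ⟨h, rfl⟩ := Prod.ext_iff.1 hk
    obtain rfl : k = 0 := (cancel_mono T.f).1 (h.trans zero_comp.symm)
    exact zero_comp
  · rintro s t a x m ⟨k, hk⟩
    obtain ⟨_, ⟨z, rfl⟩, h⟩ := (hT.pureSubfunctor (ι := ι)).pure a (x := x)
      ⟨k, congrArg Prod.fst hk⟩
    exact ⟨_, _, ⟨z, rfl⟩, h⟩

variable [HasFiniteBiproducts C]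

lemma IsPartialHom.exists_hom {Γ : ∀ s, AddSubgroup ((ι.obj s ⟶ X) × (ι.obj s ⟶ M))}
    (hΓ : IsPartialHom ι Γ)
    (hM : ∀ G : C, directSumsOfFinitelyPresented C (Cardinal.mk (Σ s : S, FormalExpr S s)) G →
      IsPureInjectiveRel.{w} M G) :
    ∃ g : X ⟶ M, ∀ (s : S) (x : ι.obj s ⟶ X) (m : ι.obj s ⟶ M), (x, m) ∈ Γ s → x ≫ g = m := by
  classical
  obtain ⟨Δ, hle, hΔ⟩ := zorn_le_nonempty₀ {Γ | IsPartialHom (X := X) (M := M) ι Γ}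
    (fun c hc hc' y hy ↦ ⟨sSup c, isPartialHom_sSup ι hc hc' ⟨y, hy⟩, fun z hz ↦ le_sSup hz⟩) Γ hΓ
  have hΔ' : IsPartialHom ι Δ := hΔ.prop
  have total (s : S) (x : ι.obj s ⟶ X) : ∃ m, (x, m) ∈ Δ s := by
    -- The extension step adjoins one element over every object of `S`; the elements away from `s`
    -- are taken to be 0.
    obtain ⟨Δ', h, hle', h'⟩ := hΔ'.exists_extension hM (Function.update 0 s x)
    obtain ⟨m, hm⟩ := h' s
    exact ⟨m, hΔ.le_of_ge h hle' s (by simpa using hm)⟩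
  choose φ hφ using total
  obtain ⟨g, hg⟩ := exists_hom_of_natural ι φ fun {s t} a x ↦
    hΔ'.unique (hφ _ _) (hΔ'.precomp a (hφ t x))
  exact ⟨g, fun s x m h ↦ by rw [hg]; exact hΔ'.unique (hφ s x) (hle s h)⟩

lemma isPureInjective_of_isPureInjectiveRel (ι : S ⥤ C) [IsFinitelyPresentableModel ι]
    (hM : ∀ G : C, directSumsOfFinitelyPresented C (Cardinal.mk (Σ s : S, FormalExpr S s)) G →
      IsPureInjectiveRel.{w} M G) : IsPureInjective.{w} M := by
  rintro K X i ⟨L, p, zero, hT⟩ f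
  obtain ⟨g, hg⟩ := (isPartialHom_of_isPure (ι := ι) hT f).exists_hom hM
  refine ⟨g, hom_ext_of_model ι fun s x ↦ ?_⟩
  rw [← Category.assoc]
  exact hg s _ _ ⟨x, rfl⟩

end Extension

end PureExact

theorem mainTheorem9 (C : Type u) [Category.{v} C] [Preadditive C] [HasFiniteBiproducts C]
    [IsFinitelyAccessibleCategory.{w} C] :
    ∃ κ : Cardinal.{w}, ∀ M : C,
      (∀ G : C, PureExact.directSumsOfFinitelyPresented C κ G →
        PureExact.IsPureInjectiveRel.{w} M G) →
      PureExact.IsPureInjective.{w} M := by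
  obtain ⟨S, _, ι, _⟩ := PureExact.exists_isFinitelyPresentableModel C
  exact ⟨_, fun M hM ↦ PureExact.isPureInjective_of_isPureInjectiveRel ι hM⟩
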